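/- Let $f$ be a real-valued function on $(-1,1)$, extended by zero to $\mathbb{R}$, such that $f(x)(1-x^2)^{1/4} \in L^2(-1,1)$. Suppose that its Hilbert transform $$ (Hf)(x) = \mathrm{p.v.}\ \frac{1}{\pi}\int_{\mathbb{R}} \frac{f(y)}{x-y}\,dy = \lim_{\varepsilon \to 0^+} \frac{1}{\pi}\int_{|x-y|>\varepsilon} \frac{f(y)}{x-y}\,dy $$ vanishes on $(-1,1)$, i.e. for almost every $x \in (-1,1)$ this limit exists and equals $0$. Then there is a constant $c \in \mathbb{R}$ such that $$ f(x) = \frac{c}{\sqrt{1-x^2}}\,\chi_{(-1,1)}(x) \qquad \text{for almost every } x \in \mathbb{R}. $$ -/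

import Mathlib

open MeasureTheory Set Filter
open scoped Topology

noncomputable section

/-- The truncated Hilbert transform `(1/π) ∫_{|x - y| > ε} f(y) / (x - y) dy`. -/
def truncatedHilbert (f : ℝ → ℝ) (ε x : ℝ) : ℝ :=
  (1 / Real.pi) * ∫ y in {y : ℝ | ε < |x - y|}, f y / (x - y)

/-- The Hilbert transform `(Hf)(x) = p.v. (1/π) ∫_ℝ f(y) / (x - y) dy` exists at `x`, as a
principal value, and is equal to `a`. -/
def HasHilbertTransformAt (f : ℝ → ℝ) (a x : ℝ) : Prop :=
  Tendsto (fun ε : ℝ => truncatedHilbert f ε x) (𝓝[>] (0 : ℝ)) (𝓝 a)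

end

/-!
Put `x = cos φ` and `F(x) = f(x) √(1 - x²)`. The hypothesis says that `F` is square integrable for
the Chebyshev measure `dx / √(1 - x²)`; in particular `f` is integrable. The Hilbert transform sends
`T_{n+1} / √(1 - x²)` to a multiple of `U_n`, so formally `H f` is a multiple of `∑ a_{n+1} U_n`
with `a_n = ∫ f T_n`, and `H f = 0` forces `a_n = 0` for `n ≥ 1`. Then `f - c / √(1 - x²)`, with
`π c = ∫ f`, is orthogonal to all polynomials, hence zero
(`ae_eq_const_div_sqrt_of_integral_mul_T`).

The work lies in reading the formal series as a pointwise principal value. No maximal function and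
no Lebesgue points are needed:

* The conjugate Poisson kernel `t / (t² + ε²)` is an average of the truncations of `1 / t`, so
  wherever the principal value is `0`, the conjugate Poisson integrals at height `ε` over `x` tend
  to `0` (`tendsto_integral_conjPoisson`).
* The Abel means `∑ rⁿ⁺¹ a_{n+1} U_n(x)` are the integrals of `f` against an explicit kernel
  (`hasSum_integral_chebyshevKernel`). Geometrically, `ζ = r e^{iφ}` is mapped by
  `(ζ + ζ⁻¹) / 2` to a point over `a x`, `a = (r + r⁻¹) / 2`, at a height `ε` for which `(a - 1) x`
  is `O(ε²)`. Hence this kernel differs from minus half the conjugate Poisson kernel over `x` by a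
  quantity that is bounded in `y` and `r` and tends to `0` off the diagonal
  (`abs_chebyshevKernel_add_le`, `tendsto_chebyshevKernel_add`), and dominated convergence with
  `f ∈ L¹` shows that the Abel means tend to `0` almost everywhere on `(-1, 1)`.
* By Bessel's inequality the `a_{n+1}` are square summable, so the Abel means, multiplied by
  `√(1 - x²)`, are bounded in `L²`; together with convergence to `0` almost everywhere this gives
  weak convergence to `0`, and so the coefficients vanish (`eq_zero_of_tendsto_abel`).
-/

/-! ### Conjugate Poisson integrals as averages of truncations -/

theorem integrable_div_sub_restrict {g : ℝ → ℝ} (hg : Integrable g) (x : ℝ) {s : ℝ} (hs : 0 < s) :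
    Integrable (fun y => {y : ℝ | s < |x - y|}.indicator (fun y => g y / (x - y)) y) := by
  have hm : MeasurableSet {y : ℝ | s < |x - y|} := measurableSet_lt (by fun_prop) (by fun_prop)
  refine (hg.norm.mul_const s⁻¹).mono' ?_ (Eventually.of_forall fun y => ?_)
  · exact (hg.aestronglyMeasurable.aemeasurable.div (by fun_prop)).aestronglyMeasurable.indicator hm
  · by_cases hy : s < |x - y|
    · rw [indicator_of_mem (show y ∈ {y : ℝ | s < |x - y|} from hy), norm_div, div_eq_mul_inv]
      gcongr
      exact hy.le
    · rw [indicator_of_notMem (show y ∉ {y : ℝ | s < |x - y|} from hy)]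
      simp only [norm_zero]
      positivity

theorem abs_setIntegral_div_sub_le {g : ℝ → ℝ} (hg : Integrable g) (x : ℝ) {s : ℝ} (hs : 0 < s) :
    |∫ y in {y : ℝ | s < |x - y|}, g y / (x - y)| ≤ (∫ y, |g y|) * s⁻¹ := by
  have hm : MeasurableSet {y : ℝ | s < |x - y|} := measurableSet_lt (by fun_prop) (by fun_prop)
  rw [← integral_indicator hm, ← integral_mul_const]
  refine (abs_integral_le_integral_abs).trans
    (integral_mono (integrable_div_sub_restrict hg x hs).norm (hg.norm.mul_const s⁻¹) fun y => ?_)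
  change ‖{y : ℝ | s < |x - y|}.indicator (fun y => g y / (x - y)) y‖ ≤ ‖g y‖ * s⁻¹
  by_cases hy : s < |x - y|
  · rw [indicator_of_mem (show y ∈ {y : ℝ | s < |x - y|} from hy), norm_div, div_eq_mul_inv]
    gcongr
    exact hy.le
  · rw [indicator_of_notMem (show y ∉ {y : ℝ | s < |x - y|} from hy), norm_zero]
    positivity

theorem integral_two_mul_div_sq (u : ℝ) (hu : 0 ≤ u) :
    ∫ t in Ioo 0 u, 2 * t / (t ^ 2 + 1) ^ 2 = u ^ 2 / (u ^ 2 + 1) := by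
  rw [← integral_Ioc_eq_integral_Ioo, ← intervalIntegral.integral_of_le hu]
  have hd : ∀ t ∈ uIcc 0 u,
      HasDerivAt (fun t : ℝ => -(t ^ 2 + 1)⁻¹) (2 * t / (t ^ 2 + 1) ^ 2) t := by
    intro t _
    have h : HasDerivAt (fun t : ℝ => t ^ 2 + 1) (2 * t) t := by
      simpa using (hasDerivAt_pow 2 t).add_const 1
    have h' := (h.inv (by positivity)).neg
    rwa [neg_div, neg_neg] at h'
  rw [intervalIntegral.integral_eq_sub_of_hasDerivAt hd]
  · field_simp
    ring
  · refine Continuous.intervalIntegrable ?_ _ _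
    exact Continuous.div (by fun_prop) (by fun_prop) fun t => by positivity

theorem integrable_inv_sq_add_one_sq : Integrable (fun t : ℝ => ((t ^ 2 + 1) ^ 2)⁻¹) := by
  refine integrable_inv_one_add_sq.mono' ?_ (Eventually.of_forall fun t => ?_)
  · exact Continuous.aestronglyMeasurable
      (Continuous.inv₀ (by fun_prop) fun t => by positivity)
  · rw [Real.norm_of_nonneg (by positivity)]
    refine inv_anti₀ (by positivity) ?_
    nlinarith [sq_nonneg t]

theorem integrableOn_two_mul_div_sq :
    IntegrableOn (fun t : ℝ => 2 * t / (t ^ 2 + 1) ^ 2) (Ioi 0) := by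
  refine (integrable_inv_one_add_sq.integrableOn).mono' ?_ (Eventually.of_forall fun t => ?_)
  · exact (Continuous.div (by fun_prop) (by fun_prop)
      fun t => by positivity).aestronglyMeasurable
  · rw [norm_div, Real.norm_of_nonneg (by positivity : (0 : ℝ) ≤ (t ^ 2 + 1) ^ 2), Real.norm_eq_abs,
      div_le_iff₀ (by positivity)]
    have : (1 + t ^ 2)⁻¹ * (t ^ 2 + 1) ^ 2 = t ^ 2 + 1 := by
      field_simp
      ring
    rw [this, abs_le]
    constructor <;> nlinarith [sq_nonneg (t - 1), sq_nonneg (t + 1)]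

/-- The conjugate Poisson kernel is an average of truncations of the Hilbert kernel: the layer
cake formula for `u ↦ u² / (u² + 1)` together with Fubini. -/
theorem integral_conjPoisson_eq {g : ℝ → ℝ} (hg : Integrable g) (x : ℝ) {ε : ℝ} (hε : 0 < ε) :
    ∫ y, g y * ((x - y) / ((x - y) ^ 2 + ε ^ 2)) =
      ∫ t in Ioi (0 : ℝ), (2 * t / (t ^ 2 + 1) ^ 2) *
        ∫ y in {y : ℝ | ε * t < |x - y|}, g y / (x - y) := by
  have hm : ∀ s, MeasurableSet {y : ℝ | s < |x - y|} :=
    fun s => measurableSet_lt (by fun_prop) (by fun_prop)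
  -- After the scaling `s = ε t` the truncated kernels are averaged over the truncation level `s`.
  let Φ : ℝ → ℝ → ℝ := fun t y => (2 * t / (t ^ 2 + 1) ^ 2) *
    {y : ℝ | ε * t < |x - y|}.indicator (fun y => g y / (x - y)) y
  have hΦ : Integrable (Function.uncurry Φ) ((volume.restrict (Ioi (0 : ℝ))).prod volume) := by
    have hdom : Integrable (fun p : ℝ × ℝ => ((p.1 ^ 2 + 1) ^ 2)⁻¹ * (2 / ε * |g p.2|))
        ((volume.restrict (Ioi (0 : ℝ))).prod volume) :=
      (integrable_inv_sq_add_one_sq.integrableOn).mul_prod (hg.abs.const_mul _)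
    refine hdom.mono' ?_ ?_
    · have h1 : AEMeasurable (fun p : ℝ × ℝ => g p.2 / (x - p.2))
          ((volume.restrict (Ioi (0 : ℝ))).prod volume) :=
        (hg.aestronglyMeasurable.comp_snd).aemeasurable.div (by fun_prop)
      have hs : MeasurableSet {p : ℝ × ℝ | ε * p.1 < |x - p.2|} :=
        measurableSet_lt (by fun_prop) (by fun_prop)
      have h2 : AEMeasurable (fun p : ℝ × ℝ => 2 * p.1 / (p.1 ^ 2 + 1) ^ 2)
          ((volume.restrict (Ioi (0 : ℝ))).prod volume) := by fun_prop
      exact (h2.mul (h1.indicator hs)).aestronglyMeasurable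
    · have hpos : ∀ᵐ p : ℝ × ℝ ∂((volume.restrict (Ioi (0 : ℝ))).prod volume), 0 < p.1 :=
        Measure.quasiMeasurePreserving_fst.ae (ae_restrict_mem measurableSet_Ioi)
      filter_upwards [hpos] with p hp
      simp only [Φ, Function.uncurry]
      by_cases hy : ε * p.1 < |x - p.2|
      · rw [indicator_of_mem (show p.2 ∈ {y : ℝ | ε * p.1 < |x - y|} from hy), norm_mul, norm_div,
          norm_div, Real.norm_of_nonneg (by positivity : (0 : ℝ) ≤ 2 * p.1),
          Real.norm_of_nonneg (by positivity : (0 : ℝ) ≤ (p.1 ^ 2 + 1) ^ 2), Real.norm_eq_abs,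
          Real.norm_eq_abs]
        calc 2 * p.1 / (p.1 ^ 2 + 1) ^ 2 * (|g p.2| / |x - p.2|)
            ≤ 2 * p.1 / (p.1 ^ 2 + 1) ^ 2 * (|g p.2| / (ε * p.1)) := by gcongr
          _ = ((p.1 ^ 2 + 1) ^ 2)⁻¹ * (2 / ε * |g p.2|) := by field_simp
      · rw [indicator_of_notMem (show p.2 ∉ {y : ℝ | ε * p.1 < |x - y|} from hy), mul_zero,
          norm_zero]
        positivity
  have hswap := integral_integral_swap hΦ
  have hleft : ∀ t, ∫ y, Φ t y = (2 * t / (t ^ 2 + 1) ^ 2) *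
      ∫ y in {y : ℝ | ε * t < |x - y|}, g y / (x - y) := fun t => by
    simp only [Φ]
    rw [integral_const_mul, integral_indicator (hm _)]
  have hright : ∀ y, ∫ t in Ioi (0 : ℝ), Φ t y = g y * ((x - y) / ((x - y) ^ 2 + ε ^ 2)) := by
    intro y
    have h1 : ∀ t, Φ t y = (Iio (|x - y| / ε)).indicator (fun t : ℝ => 2 * t / (t ^ 2 + 1) ^ 2) t
        * (g y / (x - y)) := by
      intro t
      simp only [Φ, indicator, mem_ofPred_eq, mem_Iio, lt_div_iff₀ hε, mul_comm ε t]
      split_ifs <;> simp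
    simp_rw [h1]
    rw [integral_mul_const, setIntegral_indicator measurableSet_Iio, Ioi_inter_Iio,
      integral_two_mul_div_sq _ (by positivity), div_pow, sq_abs]
    rcases eq_or_ne (x - y) 0 with h0 | h0
    · simp [h0]
    · field_simp
  simp_rw [hleft, hright] at hswap
  exact hswap.symm

/-- Existence of the principal value `0` at `x` passes to the limit of the conjugate Poisson
integrals over `x`; no Lebesgue point property of `x` is needed. -/
theorem tendsto_integral_conjPoisson {g : ℝ → ℝ} (hg : Integrable g) {x : ℝ}
    (hx : HasHilbertTransformAt g 0 x) :
    Tendsto (fun ε : ℝ => ∫ y, g y * ((x - y) / ((x - y) ^ 2 + ε ^ 2))) (𝓝[>] 0) (𝓝 0) := by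
  set T : ℝ → ℝ := fun s => ∫ y in {y : ℝ | s < |x - y|}, g y / (x - y) with hT
  have hT0 : Tendsto T (𝓝[>] 0) (𝓝 0) := by
    have h := hx.const_mul Real.pi
    simp only [truncatedHilbert, mul_zero] at h
    refine h.congr fun s => ?_
    field_simp
    rfl
  obtain ⟨M, hM⟩ : ∃ M, ∀ s, 0 < s → |T s| ≤ M := by
    have h1 : ∀ᶠ s in 𝓝[>] (0 : ℝ), |T s| < 1 := by
      simpa using hT0.abs.eventually_lt_const (by simp : |(0 : ℝ)| < 1)
    obtain ⟨δ, hδ, h⟩ := mem_nhdsGT_iff_exists_Ioo_subset.1 h1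
    have hδ' : (0 : ℝ) < δ := hδ
    -- Near `0` the truncations are small by assumption; away from `0` the kernel is bounded.
    refine ⟨max 1 ((∫ y, |g y|) * δ⁻¹), fun s hs => ?_⟩
    rcases lt_or_ge s δ with hsd | hsd
    · exact (h ⟨hs, hsd⟩).le.trans (le_max_left _ _)
    · refine (abs_setIntegral_div_sub_le hg x hs).trans (le_trans ?_ (le_max_right _ _))
      have : 0 ≤ ∫ y, |g y| := integral_nonneg fun y => abs_nonneg (g y)
      gcongr
  have hmeas : ∀ ε, AEStronglyMeasurable (fun t => (2 * t / (t ^ 2 + 1) ^ 2) * T (ε * t))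
      (volume.restrict (Ioi (0 : ℝ))) := by
    intro ε
    refine AEStronglyMeasurable.mul ?_ ?_
    · exact (Continuous.div (by fun_prop) (by fun_prop)
        fun t => by positivity).aestronglyMeasurable
    · have h1 : AEMeasurable (fun p : ℝ × ℝ => g p.2 / (x - p.2))
          ((volume.restrict (Ioi (0 : ℝ))).prod volume) :=
        (hg.aestronglyMeasurable.comp_snd).aemeasurable.div (by fun_prop)
      have hs : MeasurableSet {p : ℝ × ℝ | ε * p.1 < |x - p.2|} :=
        measurableSet_lt (by fun_prop) (by fun_prop)
      have := (h1.indicator hs).aestronglyMeasurable.integral_prod_right'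
      refine this.congr (Eventually.of_forall fun t => ?_)
      simp only [hT]
      rw [← integral_indicator (measurableSet_lt (by fun_prop) (by fun_prop))]
      rfl
  -- The weight in `t` does not depend on `ε`, and `T` is bounded: dominated convergence applies.
  have key : Tendsto (fun ε : ℝ => ∫ t in Ioi (0 : ℝ), (2 * t / (t ^ 2 + 1) ^ 2) * T (ε * t))
      (𝓝[>] 0) (𝓝 (∫ t in Ioi (0 : ℝ), (0 : ℝ))) := by
    refine tendsto_integral_filter_of_dominated_convergence
      (fun t => 2 * t / (t ^ 2 + 1) ^ 2 * M) (Eventually.of_forall hmeas) ?_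
      (integrableOn_two_mul_div_sq.mul_const M) ?_
    · filter_upwards [self_mem_nhdsWithin] with ε hε
      filter_upwards [ae_restrict_mem measurableSet_Ioi] with t ht
      have ht' : (0 : ℝ) < t := ht
      have hε' : (0 : ℝ) < ε := hε
      rw [norm_mul, Real.norm_of_nonneg (by positivity : (0 : ℝ) ≤ 2 * t / (t ^ 2 + 1) ^ 2)]
      gcongr
      exact hM _ (by positivity)
    · filter_upwards [ae_restrict_mem measurableSet_Ioi] with t ht
      have ht' : (0 : ℝ) < t := ht
      have h1 : Tendsto (fun ε : ℝ => ε * t) (𝓝[>] 0) (𝓝[>] 0) := by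
        refine tendsto_nhdsWithin_iff.2 ⟨?_, ?_⟩
        · have : Tendsto (fun ε : ℝ => ε * t) (𝓝 0) (𝓝 (0 * t)) := tendsto_id.mul_const t
          rw [zero_mul] at this
          exact this.mono_left nhdsWithin_le_nhds
        · filter_upwards [self_mem_nhdsWithin] with ε hε
          exact mul_pos hε ht'
      simpa using (hT0.comp h1).const_mul (2 * t / (t ^ 2 + 1) ^ 2)
  rw [integral_zero] at key
  refine key.congr' ?_
  filter_upwards [self_mem_nhdsWithin] with ε hε
  exact (integral_conjPoisson_eq hg x hε).symm

/-! ### The generating kernel of the Chebyshev polynomials -/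

open Polynomial.Chebyshev (T U measureT)

theorem hasSum_pow_mul_sin {r : ℝ} (hr : |r| < 1) (t : ℝ) :
    HasSum (fun n : ℕ => r ^ (n + 1) * Real.sin ((n + 1) * t))
      (r * Real.sin t / (1 - 2 * r * Real.cos t + r ^ 2)) := by
  let z : ℂ := r * (Complex.cos t + Complex.sin t * Complex.I)
  have hz : ‖z‖ < 1 := by
    simp only [z, norm_mul, Complex.norm_real, ← Complex.exp_mul_I, Complex.norm_exp_ofReal_mul_I,
      mul_one]
    exact hr
  have h := Complex.hasSum_im ((hasSum_geometric_of_norm_lt_one hz).mul_left z)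
  have h1 : ∀ n : ℕ, (z * z ^ n).im = r ^ (n + 1) * Real.sin ((n + 1) * t) := by
    intro n
    rw [← pow_succ', mul_pow, Complex.cos_add_sin_mul_I_pow]
    have : ((n + 1 : ℕ) : ℂ) * (t : ℂ) = (((n + 1) * t : ℝ) : ℂ) := by push_cast; ring
    rw [this, ← Complex.ofReal_cos, ← Complex.ofReal_sin, ← Complex.ofReal_pow,
      Complex.im_ofReal_mul]
    simp [-Complex.ofReal_cos, -Complex.ofReal_sin, -Complex.ofReal_mul, -Complex.ofReal_add,
      -Complex.ofReal_natCast]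
  have hre : z.re = r * Real.cos t := by
    simp [z, ← Complex.ofReal_cos, ← Complex.ofReal_sin]
  have him : z.im = r * Real.sin t := by
    simp [z, ← Complex.ofReal_cos, ← Complex.ofReal_sin]
  have h2 : (z * (1 - z)⁻¹).im = r * Real.sin t / (1 - 2 * r * Real.cos t + r ^ 2) := by
    have hn : Complex.normSq (1 - z) = 1 - 2 * r * Real.cos t + r ^ 2 := by
      rw [Complex.normSq_apply]
      simp only [Complex.sub_re, Complex.sub_im, Complex.one_re, Complex.one_im, hre, him]
      linear_combination r ^ 2 * Real.sin_sq_add_cos_sq t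
    rw [← hn, Complex.mul_im, Complex.inv_re, Complex.inv_im]
    simp only [Complex.sub_re, Complex.sub_im, Complex.one_re, Complex.one_im, hre, him]
    ring
  simp_rw [h1, h2] at h
  exact h

/-- The sum of `∑ rⁿ⁺¹ U n x T (n + 1) y` for `|r| < 1` and `x`, `y` in the interval, as a rational
function of `x`, `y` and `r`; see `hasSum_chebyshevKernel`. -/
noncomputable def chebyshevKernel (r x y : ℝ) : ℝ :=
  r * ((1 + r ^ 2) * y - 2 * r * x) /
    ((2 * r * y - (1 + r ^ 2) * x) ^ 2 + (1 - r ^ 2) ^ 2 * (1 - x ^ 2))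

theorem abs_sqrt_mul_eval_U_le {x : ℝ} (hx : x ∈ Icc (-1 : ℝ) 1) (n : ℕ) :
    |√(1 - x ^ 2) * (U ℝ n).eval x| ≤ 1 := by
  have h := Polynomial.Chebyshev.U_real_cos (Real.arccos x) n
  rw [Real.cos_arccos hx.1 hx.2, Real.sin_arccos] at h
  rw [mul_comm, h]
  exact Real.abs_sin_le_one _

theorem one_sub_two_mul_cos_add_sq_pos {r : ℝ} (hr : |r| < 1) (t : ℝ) :
    0 < 1 - 2 * r * Real.cos t + r ^ 2 := by
  have hr2 : r ^ 2 < 1 := (sq_lt_one_iff_abs_lt_one r).2 hr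
  rcases eq_or_ne (Real.sin t) 0 with h | h
  · have hc : Real.cos t ^ 2 = 1 := by nlinarith [Real.sin_sq_add_cos_sq t]
    have : r * Real.cos t ≠ 1 := fun h1 => by
      have : r ^ 2 * Real.cos t ^ 2 = 1 := by rw [← mul_pow, h1, one_pow]
      rw [hc] at this
      linarith
    have h2 : 0 < (r * Real.cos t - 1) ^ 2 := by
      have := sub_ne_zero.2 this
      positivity
    nlinarith
  · have : 0 < Real.sin t ^ 2 := by positivity
    nlinarith [Real.sin_sq_add_cos_sq t, sq_nonneg (r - Real.cos t)]

theorem hasSum_chebyshevKernel {r x y : ℝ} (hr : |r| < 1) (hx : x ∈ Ioo (-1 : ℝ) 1)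
    (hy : y ∈ Icc (-1 : ℝ) 1) :
    HasSum (fun n : ℕ => r ^ (n + 1) * (U ℝ n).eval x * (T ℝ (n + 1)).eval y)
      (chebyshevKernel r x y) := by
  -- `2 sin ((n + 1) φ) cos ((n + 1) θ)` is a sum of two sines, and each series is geometric.
  obtain ⟨φ, hφ⟩ : ∃ φ, φ = Real.arccos x := ⟨_, rfl⟩
  obtain ⟨θ, hθ⟩ : ∃ θ, θ = Real.arccos y := ⟨_, rfl⟩
  have hxφ : Real.cos φ = x := hφ ▸ Real.cos_arccos hx.1.le hx.2.le
  have hyθ : Real.cos θ = y := hθ ▸ Real.cos_arccos hy.1 hy.2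
  have hs : 0 < Real.sin φ := by
    rw [hφ, Real.sin_arccos]
    exact Real.sqrt_pos.2 (by nlinarith [hx.1, hx.2])
  have h := ((hasSum_pow_mul_sin hr (φ - θ)).add (hasSum_pow_mul_sin hr (φ + θ))).mul_left
    ((2 * Real.sin φ)⁻¹)
  have h1 : ∀ n : ℕ, (2 * Real.sin φ)⁻¹ * (r ^ (n + 1) * Real.sin ((n + 1) * (φ - θ)) +
      r ^ (n + 1) * Real.sin ((n + 1) * (φ + θ))) =
      r ^ (n + 1) * (U ℝ n).eval x * (T ℝ (n + 1)).eval y := by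
    intro n
    have hU := Polynomial.Chebyshev.U_real_cos φ n
    have hT := Polynomial.Chebyshev.T_real_cos θ (n + 1)
    push_cast at hU hT
    rw [← hxφ, ← hyθ, hT, mul_sub, mul_add ((n : ℝ) + 1), Real.sin_sub, Real.sin_add,
      ← hU]
    field_simp
    ring
  simp_rw [h1] at h
  have hp1 := one_sub_two_mul_cos_add_sq_pos hr (φ - θ)
  have hp2 := one_sub_two_mul_cos_add_sq_pos hr (φ + θ)
  have hprod : (1 - 2 * r * Real.cos (φ - θ) + r ^ 2) * (1 - 2 * r * Real.cos (φ + θ) + r ^ 2) =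
      (2 * r * y - (1 + r ^ 2) * x) ^ 2 + (1 - r ^ 2) ^ 2 * (1 - x ^ 2) := by
    rw [Real.cos_sub, Real.cos_add, hxφ, hyθ]
    have e1 : Real.sin φ ^ 2 = 1 - x ^ 2 := by rw [← hxφ, Real.sin_sq]
    have e2 : Real.sin θ ^ 2 = 1 - y ^ 2 := by rw [← hyθ, Real.sin_sq]
    linear_combination (-4 * r ^ 2 * Real.sin θ ^ 2) * e1 + (-4 * r ^ 2 * (1 - x ^ 2)) * e2
  refine (?_ : _ = chebyshevKernel r x y) ▸ h
  rw [div_add_div _ _ hp1.ne' hp2.ne', hprod, chebyshevKernel, mul_div_assoc']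
  congr 1
  symm
  rw [eq_inv_mul_iff_mul_eq₀ (by positivity), Real.cos_sub, Real.cos_add, Real.sin_sub,
    Real.sin_add, hxφ, hyθ]
  have e2 : Real.sin θ ^ 2 = 1 - y ^ 2 := by rw [← hyθ, Real.sin_sq]
  linear_combination (4 * r ^ 2 * x * Real.sin φ) * e2

/-- A shift of the base point by `O(ε²)` changes the conjugate Poisson kernel at height `ε` by a
bounded amount only. -/
theorem abs_conjPoisson_sub_le (p q : ℝ) {ε : ℝ} (hε : 0 < ε) :
    |p / (p ^ 2 + ε ^ 2) - q / (q ^ 2 + ε ^ 2)| ≤ |p - q| / ε ^ 2 := by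
  have hp : 0 < p ^ 2 + ε ^ 2 := by positivity
  have hq : 0 < q ^ 2 + ε ^ 2 := by positivity
  have h : p / (p ^ 2 + ε ^ 2) - q / (q ^ 2 + ε ^ 2) =
      (p - q) * ((ε ^ 2 - p * q) / ((p ^ 2 + ε ^ 2) * (q ^ 2 + ε ^ 2))) := by
    field_simp
    ring
  rw [h, abs_mul, div_eq_mul_inv |p - q|]
  refine mul_le_mul_of_nonneg_left ?_ (abs_nonneg _)
  rw [abs_le]
  have hε2 : 0 < ε ^ 2 := by positivity
  constructor
  · rw [le_div_iff₀ (mul_pos hp hq), ← mul_le_mul_iff_right₀ hε2, neg_mul, mul_neg,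
      mul_inv_cancel_left₀ hε2.ne']
    nlinarith [sq_nonneg (p * q), mul_nonneg hε2.le (sq_nonneg (p - q)), sq_nonneg (ε ^ 2),
      mul_nonneg hε2.le (sq_nonneg p), mul_nonneg hε2.le (sq_nonneg q)]
  · rw [div_le_iff₀ (mul_pos hp hq), ← mul_le_mul_iff_right₀ hε2, mul_inv_cancel_left₀ hε2.ne']
    nlinarith [sq_nonneg (p * q), mul_nonneg hε2.le (sq_nonneg (p + q)), sq_nonneg (ε ^ 2),
      mul_nonneg hε2.le (sq_nonneg p), mul_nonneg hε2.le (sq_nonneg q)]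

/-- The shifted kernel `(a y - x) / ((y - a x)² + ε²)` with `ε = b s` differs from
`(y - x) / ((y - x)² + ε²)` by a bounded amount, since the shift `(a - 1) x` is of the order of `ε²`. -/
theorem abs_shifted_add_le {a b s x : ℝ} (hb0 : 0 < b) (hb1 : b ≤ 1) (hs0 : 0 < s) (hs1 : s ≤ 1)
    (ha1 : 1 ≤ a) (hab : a ^ 2 - 1 = b ^ 2) (hx : |x| ≤ 1) (y : ℝ) :
    |(a * y - x) / ((y - a * x) ^ 2 + (b * s) ^ 2) + (x - y) / ((x - y) ^ 2 + (b * s) ^ 2)|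
      ≤ 3 / s ^ 2 := by
  have hab' : a - 1 ≤ b ^ 2 := by nlinarith
  obtain ⟨ε, hε⟩ : ∃ ε, ε = b * s := ⟨_, rfl⟩
  have hε0 : 0 < ε := hε ▸ mul_pos hb0 hs0
  obtain ⟨p, hp⟩ : ∃ p, p = y - a * x := ⟨_, rfl⟩
  obtain ⟨q, hq⟩ : ∃ q, q = y - x := ⟨_, rfl⟩
  have hP : 0 < p ^ 2 + ε ^ 2 := by positivity
  have hεP : ε ^ 2 ≤ p ^ 2 + ε ^ 2 := le_add_of_nonneg_left (sq_nonneg p)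
  have ha0 : 0 ≤ a - 1 := by linarith
  have hsplit : (a * y - x) / (p ^ 2 + ε ^ 2) + (x - y) / ((x - y) ^ 2 + ε ^ 2) =
      (p / (p ^ 2 + ε ^ 2) - q / (q ^ 2 + ε ^ 2)) + (a - 1) * p / (p ^ 2 + ε ^ 2) +
        b ^ 2 * x / (p ^ 2 + ε ^ 2) := by
    rw [show (x - y) ^ 2 = q ^ 2 by rw [hq]; ring, show x - y = -q by rw [hq]; ring,
      show a * y - x = p + (a - 1) * p + b ^ 2 * x by rw [hp, ← hab]; ring, add_div, add_div,
      neg_div]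
    ring
  rw [← hε, ← hp, hsplit]
  -- Each of the three terms is at most `1 / s²`, because `a - 1 ≤ b²` and `ε = b s`.
  have hbs : b ^ 2 / ε ^ 2 = 1 / s ^ 2 := by
    rw [hε, mul_pow]
    field_simp
  have e1 : |p / (p ^ 2 + ε ^ 2) - q / (q ^ 2 + ε ^ 2)| ≤ 1 / s ^ 2 := by
    refine (abs_conjPoisson_sub_le p q hε0).trans ?_
    rw [← hbs]
    gcongr
    rw [show p - q = -((a - 1) * x) by rw [hp, hq]; ring, abs_neg, abs_mul, abs_of_nonneg ha0]
    exact (mul_le_of_le_one_right ha0 hx).trans hab'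
  have e2 : |(a - 1) * p / (p ^ 2 + ε ^ 2)| ≤ 1 / s ^ 2 := by
    rw [abs_div, abs_of_pos hP, abs_mul, abs_of_nonneg ha0,
      div_le_div_iff₀ hP (by positivity), one_mul]
    have h1 : 2 * |p| * ε ≤ p ^ 2 + ε ^ 2 := by
      rw [← sq_abs p]
      exact two_mul_le_add_sq _ _
    have h2 : 0 ≤ |p| * ε := mul_nonneg (abs_nonneg p) hε0.le
    calc (a - 1) * |p| * s ^ 2 ≤ b ^ 2 * |p| * s ^ 2 := by gcongr
      _ = b * s * (|p| * ε) := by rw [hε]; ring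
      _ ≤ 1 * (|p| * ε) := mul_le_mul_of_nonneg_right (mul_le_one₀ hb1 hs0.le hs1) h2
      _ ≤ p ^ 2 + ε ^ 2 := by linarith
  have e3 : |b ^ 2 * x / (p ^ 2 + ε ^ 2)| ≤ 1 / s ^ 2 := by
    rw [abs_div, abs_of_pos hP, abs_mul, abs_of_pos (by positivity : 0 < b ^ 2), ← hbs]
    exact div_le_div₀ (by positivity) (mul_le_of_le_one_right (sq_nonneg b) hx) (by positivity) hεP
  calc _ ≤ _ := abs_add_three _ _ _
    _ ≤ 1 / s ^ 2 + 1 / s ^ 2 + 1 / s ^ 2 := add_le_add (add_le_add e1 e2) e3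
    _ = 3 / s ^ 2 := by ring

/-- Twice the Chebyshev kernel is minus the conjugate Poisson kernel at height
`(1 - r²) / (2r) · √(1 - x²)` over `x`, up to a bounded error. -/
theorem abs_chebyshevKernel_add_le {r x : ℝ} (hr : r ∈ Ioo (1 / 2 : ℝ) 1)
    (hx : x ∈ Ioo (-1 : ℝ) 1) (y : ℝ) :
    |2 * chebyshevKernel r x y +
        (x - y) / ((x - y) ^ 2 + ((1 - r ^ 2) / (2 * r) * √(1 - x ^ 2)) ^ 2)|
      ≤ 3 / (1 - x ^ 2) := by
  obtain ⟨hr1, hr2⟩ := hr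
  have hr0 : 0 < r := by linarith
  have hx2 : 0 < 1 - x ^ 2 := by nlinarith [hx.1, hx.2]
  obtain ⟨s, hs⟩ : ∃ s, s = √(1 - x ^ 2) := ⟨_, rfl⟩
  have hs0 : 0 < s := hs ▸ Real.sqrt_pos.2 hx2
  have hs2 : s ^ 2 = 1 - x ^ 2 := by rw [hs, Real.sq_sqrt hx2.le]
  have hs1 : s ≤ 1 := by
    rw [hs, Real.sqrt_le_iff]
    exact ⟨zero_le_one, by linarith [sq_nonneg x]⟩
  have hK : 2 * chebyshevKernel r x y = ((1 + r ^ 2) / (2 * r) * y - x) /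
      ((y - (1 + r ^ 2) / (2 * r) * x) ^ 2 + ((1 - r ^ 2) / (2 * r) * s) ^ 2) := by
    have hD : (2 * r * y - (1 + r ^ 2) * x) ^ 2 + (1 - r ^ 2) ^ 2 * (1 - x ^ 2) = (2 * r) ^ 2 *
        ((y - (1 + r ^ 2) / (2 * r) * x) ^ 2 + ((1 - r ^ 2) / (2 * r) * s) ^ 2) := by
      rw [mul_pow _ s, hs2]
      field_simp
    have hN : 2 * (r * ((1 + r ^ 2) * y - 2 * r * x)) =
        (2 * r) ^ 2 * ((1 + r ^ 2) / (2 * r) * y - x) := by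
      field_simp
    rw [chebyshevKernel, mul_div_assoc', hD, hN, mul_div_mul_left _ _ (by positivity)]
  rw [hK, ← hs2, Real.sqrt_sq hs0.le]
  refine abs_shifted_add_le (div_pos (by nlinarith) (by linarith)) ?_ hs0 hs1 ?_ ?_
    (abs_le.2 ⟨hx.1.le, hx.2.le⟩) y
  · rw [div_le_one (by linarith)]
    nlinarith
  · rw [one_le_div (by linarith)]
    linarith [sq_nonneg (r - 1), sub_sq r 1]
  · field_simp
    ring

theorem measurable_chebyshevKernel (r x : ℝ) : Measurable (chebyshevKernel r x) := by
  unfold chebyshevKernel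
  fun_prop

theorem tendsto_chebyshevKernel_add {x y : ℝ} (hxy : y ≠ x) :
    Tendsto (fun r => 2 * chebyshevKernel r x y +
      (x - y) / ((x - y) ^ 2 + ((1 - r ^ 2) / (2 * r) * √(1 - x ^ 2)) ^ 2)) (𝓝[<] 1) (𝓝 0) := by
  have hne : x - y ≠ 0 := sub_ne_zero.2 hxy.symm
  have hc : ContinuousAt (fun r => 2 * chebyshevKernel r x y +
      (x - y) / ((x - y) ^ 2 + ((1 - r ^ 2) / (2 * r) * √(1 - x ^ 2)) ^ 2)) 1 := by
    unfold chebyshevKernel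
    refine ContinuousAt.add
      (continuousAt_const.mul (ContinuousAt.div (by fun_prop) (by fun_prop) ?_))
      (ContinuousAt.div (by fun_prop) ?_ ?_)
    · have : (2 * 1 * y - (1 + 1 ^ 2) * x) ^ 2 + (1 - 1 ^ 2) ^ 2 * (1 - x ^ 2) =
        4 * (x - y) ^ 2 := by ring
      rw [this]
      positivity
    · have : ContinuousAt (fun r : ℝ => (1 - r ^ 2) / (2 * r)) 1 :=
        ContinuousAt.div (by fun_prop) (by fun_prop) (by norm_num)
      fun_prop
    · simpa using hne
  have h := hc.tendsto.mono_left (nhdsWithin_le_nhds (s := Iio 1))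
  convert h using 2
  unfold chebyshevKernel
  have h4 : (2 * 1 * y - (1 + 1 ^ 2) * x) ^ 2 + (1 - 1 ^ 2) ^ 2 * (1 - x ^ 2) =
        4 * (x - y) ^ 2 := by ring
  rw [h4, show (x - y) ^ 2 + ((1 - 1 ^ 2) / (2 * 1) * √(1 - x ^ 2)) ^ 2 = (x - y) ^ 2 by ring]
  field_simp
  ring

/-- Where the principal value is `0`, the Abel means formed with the Chebyshev kernel tend to
`0`. -/
theorem tendsto_integral_chebyshevKernel {g : ℝ → ℝ} (hg : Integrable g) {x : ℝ}
    (hx : x ∈ Ioo (-1 : ℝ) 1) (hH : HasHilbertTransformAt g 0 x) :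
    Tendsto (fun r => ∫ y, g y * chebyshevKernel r x y) (𝓝[<] 1) (𝓝 0) := by
  have hx2 : 0 < 1 - x ^ 2 := by nlinarith [hx.1, hx.2]
  obtain ⟨ε, hε⟩ : ∃ ε : ℝ → ℝ, ε = fun r => (1 - r ^ 2) / (2 * r) * √(1 - x ^ 2) := ⟨_, rfl⟩
  have hIoo : ∀ᶠ r in 𝓝[<] (1 : ℝ), r ∈ Ioo (1 / 2 : ℝ) 1 := Ioo_mem_nhdsLT (by norm_num)
  have hεpos : ∀ᶠ r in 𝓝[<] (1 : ℝ), 0 < ε r := by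
    filter_upwards [hIoo] with r hr
    rw [hε]
    exact mul_pos (div_pos (by nlinarith [hr.1, hr.2]) (by linarith [hr.1])) (Real.sqrt_pos.2 hx2)
  have hεt : Tendsto ε (𝓝[<] 1) (𝓝[>] 0) := by
    refine tendsto_nhdsWithin_iff.2 ⟨?_, hεpos⟩
    have hc : ContinuousAt ε 1 := by
      have : ContinuousAt (fun r : ℝ => (1 - r ^ 2) / (2 * r)) 1 :=
        ContinuousAt.div (by fun_prop) (by fun_prop) (by norm_num)
      rw [hε]
      fun_prop
    have h := hc.tendsto.mono_left (nhdsWithin_le_nhds (s := Iio 1))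
    simpa [hε] using h
  have hQ := (tendsto_integral_conjPoisson hg hH).comp hεt
  have hdiff : Tendsto (fun r => ∫ y, g y * (2 * chebyshevKernel r x y +
      (x - y) / ((x - y) ^ 2 + ε r ^ 2))) (𝓝[<] 1) (𝓝 (∫ _ : ℝ, (0 : ℝ))) := by
    refine tendsto_integral_filter_of_dominated_convergence
      (fun y => |g y| * (3 / (1 - x ^ 2))) (Eventually.of_forall fun r => ?_) ?_
      (hg.abs.mul_const _) ?_
    · refine hg.aestronglyMeasurable.mul (Measurable.aestronglyMeasurable ?_)
      have := measurable_chebyshevKernel r x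
      fun_prop
    · filter_upwards [hIoo] with r hr
      refine Eventually.of_forall fun y => ?_
      rw [norm_mul, Real.norm_eq_abs, Real.norm_eq_abs, hε]
      gcongr
      exact abs_chebyshevKernel_add_le hr hx y
    · have hne : ∀ᵐ y : ℝ, y ≠ x := by simp [ae_iff, measure_singleton]
      filter_upwards [hne] with y hy
      have := (tendsto_chebyshevKernel_add hy).const_mul (g y)
      rw [hε]
      simpa using this
  rw [integral_zero] at hdiff
  have hmain := (hdiff.sub hQ).const_mul (1 / 2)
  simp only [sub_zero, mul_zero] at hmain
  refine hmain.congr' ?_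
  filter_upwards [hεpos, hIoo] with r hr hr'
  have hq : Integrable (fun y => g y * ((x - y) / ((x - y) ^ 2 + ε r ^ 2))) := by
    refine (hg.abs.mul_const (ε r)⁻¹).mono' ?_ (Eventually.of_forall fun y => ?_)
    · exact hg.aestronglyMeasurable.mul (Measurable.aestronglyMeasurable (by fun_prop))
    · rw [norm_mul, Real.norm_eq_abs, Real.norm_eq_abs]
      gcongr
      rw [abs_div, abs_of_pos (by positivity : 0 < (x - y) ^ 2 + ε r ^ 2),
        div_le_iff₀ (by positivity), ← div_eq_inv_mul, le_div_iff₀ hr]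
      nlinarith [sq_nonneg (|x - y| - ε r), sq_abs (x - y), mul_nonneg (abs_nonneg (x - y)) hr.le]
  have hsum : Integrable (fun y => g y * (2 * chebyshevKernel r x y +
      (x - y) / ((x - y) ^ 2 + ε r ^ 2))) := by
    refine (hg.abs.mul_const (3 / (1 - x ^ 2))).mono' ?_ (Eventually.of_forall fun y => ?_)
    · refine hg.aestronglyMeasurable.mul (Measurable.aestronglyMeasurable ?_)
      have := measurable_chebyshevKernel r x
      fun_prop
    · rw [norm_mul, Real.norm_eq_abs, Real.norm_eq_abs, hε]
      gcongr
      exact abs_chebyshevKernel_add_le hr' hx y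
  simp only [Function.comp]
  rw [← integral_sub hsum hq, ← integral_const_mul]
  refine integral_congr_ae (Eventually.of_forall fun y => ?_)
  simp only
  ring

/-! ### Orthogonal series with Abel means tending to zero -/

theorem abs_sum_mul_le_tsum {α : Type*} {e : ℕ → α → ℝ} {b : ℕ → ℝ} {x : α}
    (hx : ∀ i, |e i x| ≤ 1) (hb : Summable fun i => |b i|) (N : ℕ) :
    |∑ i ∈ Finset.range N, b i * e i x| ≤ ∑' i, |b i| := by
  refine (Finset.abs_sum_le_sum_abs _ _).trans (le_trans (Finset.sum_le_sum fun i _ => ?_)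
    (hb.sum_le_tsum _ fun i _ => abs_nonneg _))
  rw [abs_mul]
  exact mul_le_of_le_one_right (abs_nonneg _) (hx i)

theorem summable_mul_of_abs_le_one {α : Type*} {e : ℕ → α → ℝ} {b : ℕ → ℝ} {x : α}
    (hx : ∀ i, |e i x| ≤ 1) (hb : Summable fun i => |b i|) : Summable fun i => b i * e i x := by
  refine Summable.of_norm_bounded hb fun i => ?_
  rw [norm_mul]
  exact mul_le_of_le_one_right (abs_nonneg _) (hx i)

section Orthogonal

variable {α : Type*} [MeasurableSpace α] {μ : Measure α} {e : ℕ → α → ℝ} {κ : ℝ}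

theorem integral_sq_sum_of_orthogonal (hi : ∀ i j, Integrable (fun x => e i x * e j x) μ)
    (ho : ∀ i j, ∫ x, e i x * e j x ∂μ = if i = j then κ else 0) (c : ℕ → ℝ) (N : ℕ) :
    ∫ x, (∑ i ∈ Finset.range N, c i * e i x) ^ 2 ∂μ = κ * ∑ i ∈ Finset.range N, c i ^ 2 := by
  have h1 : ∀ x, (∑ i ∈ Finset.range N, c i * e i x) ^ 2 =
      ∑ i ∈ Finset.range N, ∑ j ∈ Finset.range N, c i * c j * (e i x * e j x) := fun x => by
    rw [sq, Finset.sum_mul_sum]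
    exact Finset.sum_congr rfl fun i _ => Finset.sum_congr rfl fun j _ => by ring
  simp_rw [h1]
  rw [integral_finsetSum _ fun i _ => integrable_finsetSum _ fun j _ => (hi i j).const_mul _,
    Finset.mul_sum]
  refine Finset.sum_congr rfl fun i hiN => ?_
  rw [integral_finsetSum _ fun j _ => (hi i j).const_mul _]
  simp_rw [integral_const_mul, ho]
  simp only [mul_ite, mul_zero, Finset.sum_ite_eq, hiN, if_true]
  ring

theorem bessel_of_orthogonal (hi : ∀ i j, Integrable (fun x => e i x * e j x) μ)
    (ho : ∀ i j, ∫ x, e i x * e j x ∂μ = if i = j then κ else 0) (hκ : 0 < κ) {F : α → ℝ}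
    (hF : Integrable (fun x => F x ^ 2) μ) (hFe : ∀ i, Integrable (fun x => F x * e i x) μ)
    (N : ℕ) :
    ∑ i ∈ Finset.range N, (∫ x, F x * e i x ∂μ) ^ 2 ≤ κ * ∫ x, F x ^ 2 ∂μ := by
  set a : ℕ → ℝ := fun i => ∫ x, F x * e i x ∂μ with ha
  set S : α → ℝ := fun x => ∑ i ∈ Finset.range N, a i * e i x with hS
  have hS2 : ∫ x, S x ^ 2 ∂μ = κ * ∑ i ∈ Finset.range N, a i ^ 2 :=
    integral_sq_sum_of_orthogonal hi ho a N
  have hFSeq : ∀ x, F x * S x = ∑ i ∈ Finset.range N, a i * (F x * e i x) := fun x => by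
    rw [hS, Finset.mul_sum]
    exact Finset.sum_congr rfl fun i _ => by ring
  have hFSi : Integrable (fun x => F x * S x) μ := by
    simp_rw [hFSeq]
    exact integrable_finsetSum _ fun i _ => (hFe i).const_mul _
  have hFS : ∫ x, F x * S x ∂μ = ∑ i ∈ Finset.range N, a i ^ 2 := by
    simp_rw [hFSeq]
    rw [integral_finsetSum _ fun i _ => (hFe i).const_mul _]
    simp_rw [integral_const_mul, sq]
    rfl
  have hSi : Integrable (fun x => S x ^ 2) μ := by
    have h1 : ∀ x, S x ^ 2 =
        ∑ i ∈ Finset.range N, ∑ j ∈ Finset.range N, a i * a j * (e i x * e j x) := fun x => by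
      rw [hS, sq, Finset.sum_mul_sum]
      exact Finset.sum_congr rfl fun i _ => Finset.sum_congr rfl fun j _ => by ring
    simp_rw [h1]
    exact integrable_finsetSum _ fun i _ => integrable_finsetSum _ fun j _ => (hi i j).const_mul _
  have hpos : 0 ≤ ∫ x, (F x ^ 2 - 2 / κ * (F x * S x) + (κ ^ 2)⁻¹ * S x ^ 2) ∂μ := by
    refine integral_nonneg fun x => ?_
    have : F x ^ 2 - 2 / κ * (F x * S x) + (κ ^ 2)⁻¹ * S x ^ 2 = (F x - S x / κ) ^ 2 := by
      field_simp
      ring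
    rw [this]
    exact sq_nonneg _
  have hsub : Integrable (fun x => F x ^ 2 - 2 / κ * (F x * S x)) μ := hF.sub (hFSi.const_mul _)
  rw [integral_add hsub (hSi.const_mul _),
    integral_sub hF (hFSi.const_mul _), integral_const_mul, integral_const_mul, hS2, hFS] at hpos
  have h3 : (κ ^ 2)⁻¹ * (κ * ∑ i ∈ Finset.range N, a i ^ 2) =
      1 / κ * ∑ i ∈ Finset.range N, a i ^ 2 := by
    field_simp
  rw [h3] at hpos
  have h4 : 1 / κ * ∑ i ∈ Finset.range N, a i ^ 2 ≤ ∫ x, F x ^ 2 ∂μ := by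
    have : 2 / κ * ∑ i ∈ Finset.range N, a i ^ 2 = 2 * (1 / κ * ∑ i ∈ Finset.range N, a i ^ 2) := by
      ring
    linarith
  rw [one_div, ← div_eq_inv_mul, div_le_iff₀ hκ] at h4
  linarith

variable {b : ℕ → ℝ}

theorem aestronglyMeasurable_tsum_mul (hm : ∀ i, AEStronglyMeasurable (e i) μ)
    (hb1 : ∀ᵐ x ∂μ, ∀ i, |e i x| ≤ 1) (hb : Summable fun i => |b i|) :
    AEStronglyMeasurable (fun x => ∑' i, b i * e i x) μ := by
  refine aestronglyMeasurable_of_tendsto_ae atTop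
    (f := fun N x => ∑ i ∈ Finset.range N, b i * e i x) (fun N => ?_) ?_
  · exact Finset.aestronglyMeasurable_fun_sum _ fun i _ => (hm i).const_mul _
  · filter_upwards [hb1] with x hx
    exact (summable_mul_of_abs_le_one hx hb).hasSum.tendsto_sum_nat

variable [IsFiniteMeasure μ]

theorem integrable_mul_of_abs_le_one (hm : ∀ i, AEStronglyMeasurable (e i) μ)
    (hb : ∀ᵐ x ∂μ, ∀ i, |e i x| ≤ 1) (i j : ℕ) : Integrable (fun x => e i x * e j x) μ := by
  refine (integrable_const (1 : ℝ)).mono' ((hm i).mul (hm j)) ?_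
  filter_upwards [hb] with x hx
  rw [norm_mul]
  exact mul_le_one₀ (hx i) (norm_nonneg _) (hx j)

theorem integral_tsum_mul_of_orthogonal (hm : ∀ i, AEStronglyMeasurable (e i) μ)
    (hb1 : ∀ᵐ x ∂μ, ∀ i, |e i x| ≤ 1)
    (ho : ∀ i j, ∫ x, e i x * e j x ∂μ = if i = j then κ else 0)
    (hb : Summable fun i => |b i|) (m : ℕ) :
    ∫ x, (∑' i, b i * e i x) * e m x ∂μ = κ * b m := by
  have hi := integrable_mul_of_abs_le_one hm hb1
  have hlim : Tendsto (fun N => ∫ x, (∑ i ∈ Finset.range N, b i * e i x) * e m x ∂μ) atTop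
      (𝓝 (∫ x, (∑' i, b i * e i x) * e m x ∂μ)) := by
    refine tendsto_integral_of_dominated_convergence (fun _ => ∑' i, |b i|) (fun N => ?_)
      (integrable_const _) (fun N => ?_) ?_
    · exact (Finset.aestronglyMeasurable_fun_sum _ fun i _ => (hm i).const_mul _).mul (hm m)
    · filter_upwards [hb1] with x hx
      rw [norm_mul]
      exact (mul_le_of_le_one_right (norm_nonneg _) (hx m)).trans (abs_sum_mul_le_tsum hx hb N)
    · filter_upwards [hb1] with x hx
      exact (summable_mul_of_abs_le_one hx hb).hasSum.tendsto_sum_nat.mul_const _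
  refine tendsto_nhds_unique hlim (tendsto_const_nhds.congr' ?_)
  filter_upwards [eventually_gt_atTop m] with N hN
  simp_rw [Finset.sum_mul, mul_assoc]
  rw [integral_finsetSum _ fun i _ => (hi i m).const_mul _]
  simp_rw [integral_const_mul, ho]
  simp [hN, mul_comm]

theorem integral_tsum_sq_le_of_orthogonal (hm : ∀ i, AEStronglyMeasurable (e i) μ)
    (hb1 : ∀ᵐ x ∂μ, ∀ i, |e i x| ≤ 1)
    (ho : ∀ i j, ∫ x, e i x * e j x ∂μ = if i = j then κ else 0) (hκ : 0 ≤ κ)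
    (hb : Summable fun i => |b i|) {C : ℝ} (hC : ∀ N, ∑ i ∈ Finset.range N, b i ^ 2 ≤ C) :
    Integrable (fun x => (∑' i, b i * e i x) ^ 2) μ ∧
      ∫ x, (∑' i, b i * e i x) ^ 2 ∂μ ≤ κ * C := by
  have hbd : ∀ᵐ x ∂μ, ∀ N, ‖(∑ i ∈ Finset.range N, b i * e i x) ^ 2‖ ≤ (∑' i, |b i|) ^ 2 := by
    filter_upwards [hb1] with x hx N
    rw [norm_pow]
    exact pow_le_pow_left₀ (norm_nonneg _) (abs_sum_mul_le_tsum hx hb N) 2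
  have hconv : ∀ᵐ x ∂μ, Tendsto (fun N => (∑ i ∈ Finset.range N, b i * e i x) ^ 2) atTop
      (𝓝 ((∑' i, b i * e i x) ^ 2)) := by
    filter_upwards [hb1] with x hx
    exact (summable_mul_of_abs_le_one hx hb).hasSum.tendsto_sum_nat.pow 2
  constructor
  · refine (integrable_const ((∑' i, |b i|) ^ 2)).mono'
      ((aestronglyMeasurable_tsum_mul hm hb1 hb).pow 2) ?_
    filter_upwards [hbd, hconv] with x hx hx'
    exact le_of_tendsto hx'.norm (Eventually.of_forall hx)
  · have hlim : Tendsto (fun N => ∫ x, (∑ i ∈ Finset.range N, b i * e i x) ^ 2 ∂μ) atTop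
        (𝓝 (∫ x, (∑' i, b i * e i x) ^ 2 ∂μ)) := by
      refine tendsto_integral_of_dominated_convergence (fun _ => (∑' i, |b i|) ^ 2) (fun N => ?_)
        (integrable_const _) (fun N => hbd.mono fun x hx => hx N) hconv
      exact (Finset.aestronglyMeasurable_fun_sum _ fun i _ => (hm i).const_mul _).pow 2
    refine le_of_tendsto hlim (Eventually.of_forall fun N => ?_)
    rw [integral_sq_sum_of_orthogonal (integrable_mul_of_abs_le_one hm hb1) ho]
    exact mul_le_mul_of_nonneg_left (hC N) hκ

/-- On a finite measure space, an `L²`-bounded family that tends to `0` almost everywhere tends to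
`0` weakly against bounded functions. -/
theorem tendsto_integral_mul_of_sq_bounded {ι : Type*} {l : Filter ι} [l.IsCountablyGenerated]
    {u : ι → α → ℝ} {h : α → ℝ} {C : ℝ} (hu : ∀ᶠ i in l, AEStronglyMeasurable (u i) μ)
    (hui : ∀ᶠ i in l, Integrable (fun x => u i x ^ 2) μ)
    (huC : ∀ᶠ i in l, ∫ x, u i x ^ 2 ∂μ ≤ C) (hlim : ∀ᵐ x ∂μ, Tendsto (fun i => u i x) l (𝓝 0))
    (hh : ∀ᵐ x ∂μ, |h x| ≤ 1) :
    Tendsto (fun i => ∫ x, u i x * h x ∂μ) l (𝓝 0) := by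
  rw [Metric.tendsto_nhds]
  intro δ hδ
  obtain ⟨M, hM⟩ : ∃ M, M = 2 * (|C| + 1) / δ := ⟨_, rfl⟩
  have hC0 := abs_nonneg C
  have hM0 : 0 < M := hM ▸ by positivity
  have hmin : Tendsto (fun i => ∫ x, min |u i x| M ∂μ) l (𝓝 (∫ _, (0 : ℝ) ∂μ)) := by
    refine tendsto_integral_filter_of_dominated_convergence (fun _ => M) ?_ ?_
      (integrable_const _) ?_
    · filter_upwards [hu] with i hi
      exact hi.norm.inf aestronglyMeasurable_const
    · refine Eventually.of_forall fun i => Eventually.of_forall fun x => ?_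
      rw [Real.norm_of_nonneg (le_min (abs_nonneg _) hM0.le)]
      exact min_le_right _ _
    · filter_upwards [hlim] with x hx
      have := hx.abs.min (tendsto_const_nhds (x := M))
      rwa [abs_zero, min_eq_left hM0.le] at this
  rw [integral_zero] at hmin
  filter_upwards [hu, hui, huC, hmin.eventually_lt_const (half_pos hδ)] with i hi h2 h3 h4
  rw [Real.dist_eq, sub_zero]
  have hmi : Integrable (fun x => min |u i x| M) μ := by
    refine (integrable_const M).mono' (hi.norm.inf aestronglyMeasurable_const) ?_
    refine Eventually.of_forall fun x => ?_
    rw [Real.norm_of_nonneg (le_min (abs_nonneg _) hM0.le)]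
    exact min_le_right _ _
  -- `|u| ≤ min |u| M + u² / M`: the first term is handled by dominated convergence, the second
  -- has integral at most `C / M`.
  calc |∫ x, u i x * h x ∂μ| ≤ ∫ x, (min |u i x| M + u i x ^ 2 * M⁻¹) ∂μ := by
        rw [← Real.norm_eq_abs]
        refine norm_integral_le_of_norm_le (hmi.add (h2.mul_const _)) ?_
        filter_upwards [hh] with x hx
        rw [norm_mul]
        refine (mul_le_of_le_one_right (norm_nonneg _) hx).trans ?_
        rw [Real.norm_eq_abs, ← sq_abs (u i x)]
        rcases le_total |u i x| M with hle | hle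
        · rw [min_eq_left hle]
          exact le_add_of_nonneg_right (by positivity)
        · rw [min_eq_right hle]
          refine le_add_of_nonneg_of_le hM0.le ?_
          rw [← div_eq_mul_inv, le_div_iff₀ hM0, sq]
          exact mul_le_mul_of_nonneg_left hle (abs_nonneg _)
    _ = ∫ x, min |u i x| M ∂μ + (∫ x, u i x ^ 2 ∂μ) * M⁻¹ := by
        rw [integral_add hmi (h2.mul_const _), integral_mul_const]
    _ < δ / 2 + δ / 2 := by
        refine add_lt_add h4 ?_
        rw [← div_eq_mul_inv, div_lt_iff₀ hM0, hM]
        have : δ / 2 * (2 * (|C| + 1) / δ) = |C| + 1 := by field_simp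
        rw [this]
        linarith [le_abs_self C]
    _ = δ := add_halves δ

/-- Uniqueness for orthogonal series summed by Abel means: if the Abel means of a series with
square summable coefficients tend to `0` almost everywhere, all coefficients vanish. -/
theorem eq_zero_of_tendsto_abel (hm : ∀ i, AEStronglyMeasurable (e i) μ)
    (hb1 : ∀ᵐ x ∂μ, ∀ i, |e i x| ≤ 1)
    (ho : ∀ i j, ∫ x, e i x * e j x ∂μ = if i = j then κ else 0) (hκ : 0 < κ) {c : ℕ → ℝ} {C : ℝ}
    (hC : ∀ N, ∑ i ∈ Finset.range N, c i ^ 2 ≤ C)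
    (hlim : ∀ᵐ x ∂μ, Tendsto (fun r : ℝ => ∑' i, r ^ (i + 1) * c i * e i x) (𝓝[<] 1) (𝓝 0))
    (m : ℕ) : c m = 0 := by
  have hr : ∀ᶠ r in 𝓝[<] (1 : ℝ), r ∈ Ioo (0 : ℝ) 1 := Ioo_mem_nhdsLT zero_lt_one
  have hcb : ∀ i, |c i| ≤ |C| + 1 := fun i => by
    have h1 : c i ^ 2 ≤ C := by
      refine le_trans ?_ (hC (i + 1))
      exact Finset.single_le_sum (f := fun i => c i ^ 2) (fun j _ => sq_nonneg _)
        (Finset.self_mem_range_succ i)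
    refine abs_le_of_sq_le_sq (h1.trans ?_) (by positivity)
    nlinarith [le_abs_self C, abs_nonneg C]
  have hsum : ∀ r ∈ Ioo (0 : ℝ) 1, Summable fun i => |r ^ (i + 1) * c i| := fun r hr => by
    have hg := ((summable_geometric_of_lt_one hr.1.le hr.2).mul_left r).mul_right (|C| + 1)
    refine Summable.of_nonneg_of_le (fun i => abs_nonneg _) (fun i => ?_) hg
    rw [abs_mul, abs_of_nonneg (pow_nonneg hr.1.le _), ← pow_succ']
    exact mul_le_mul_of_nonneg_left (hcb i) (pow_nonneg hr.1.le _)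
  have hsq : ∀ r ∈ Ioo (0 : ℝ) 1, ∀ N, ∑ i ∈ Finset.range N, (r ^ (i + 1) * c i) ^ 2 ≤ C :=
    fun r hr N => by
      refine le_trans (Finset.sum_le_sum fun i _ => ?_) (hC N)
      rw [mul_pow]
      exact mul_le_of_le_one_left (sq_nonneg _)
        (pow_le_one₀ (pow_nonneg hr.1.le _) (pow_le_one₀ hr.1.le hr.2.le))
  have hweak : Tendsto (fun r : ℝ => ∫ x, (∑' i, r ^ (i + 1) * c i * e i x) * e m x ∂μ) (𝓝[<] 1)
      (𝓝 0) := by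
    refine tendsto_integral_mul_of_sq_bounded (C := κ * C) ?_ ?_ ?_ hlim
      (hb1.mono fun x hx => hx m)
    · filter_upwards [hr] with r hr
      exact aestronglyMeasurable_tsum_mul hm hb1 (hsum r hr)
    · filter_upwards [hr] with r hr
      exact (integral_tsum_sq_le_of_orthogonal hm hb1 ho hκ.le (hsum r hr) (hsq r hr)).1
    · filter_upwards [hr] with r hr
      exact (integral_tsum_sq_le_of_orthogonal hm hb1 ho hκ.le (hsum r hr) (hsq r hr)).2
  have hcoef : Tendsto (fun r : ℝ => κ * (r ^ (m + 1) * c m)) (𝓝[<] 1) (𝓝 0) := by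
    refine hweak.congr' ?_
    filter_upwards [hr] with r hr
    exact integral_tsum_mul_of_orthogonal hm hb1 ho (hsum r hr) m
  have hcont : Tendsto (fun r : ℝ => κ * (r ^ (m + 1) * c m)) (𝓝[<] 1)
      (𝓝 (κ * (1 ^ (m + 1) * c m))) := by
    have : Continuous fun r : ℝ => κ * (r ^ (m + 1) * c m) := by fun_prop
    exact this.continuousAt.tendsto.mono_left nhdsWithin_le_nhds
  have := tendsto_nhds_unique hcoef hcont
  rw [one_pow, one_mul, zero_eq_mul] at this
  exact this.resolve_left hκ.ne'

end Orthogonal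

/-! ### The Chebyshev measure and Chebyshev coefficients -/

instance isFiniteMeasure_measureT : IsFiniteMeasure measureT :=
  (integrable_const_iff_isFiniteMeasure (one_ne_zero (α := ℝ))).1
    (Polynomial.Chebyshev.integrable_measureT continuousOn_const)

theorem measureT_eq : measureT = (volume.restrict (Ioo (-1 : ℝ) 1)).withDensity
    (fun x => ENNReal.ofReal (√(1 - x ^ 2))⁻¹) := by
  rw [measureT, restrict_withDensity measurableSet_Ioc,
    Measure.restrict_congr_set Ioo_ae_eq_Ioc.symm]
  refine withDensity_congr_ae (Eventually.of_forall fun x => ?_)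
  simp only
  rw [← Real.sqrt_inv, ENNReal.ofReal_eq_coe_nnreal]

theorem measureT_absolutelyContinuous :
    measureT ≪ volume.restrict (Ioo (-1 : ℝ) 1) := by
  rw [measureT_eq]
  exact withDensity_absolutelyContinuous _ _

theorem ae_measureT_mem : ∀ᵐ x ∂measureT, x ∈ Ioo (-1 : ℝ) 1 :=
  measureT_absolutelyContinuous.ae_le (ae_restrict_mem measurableSet_Ioo)

theorem integrable_measureT_iff {h : ℝ → ℝ} :
    Integrable h measureT ↔ IntegrableOn (fun x => h x * (√(1 - x ^ 2))⁻¹) (Ioo (-1) 1) := by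
  rw [measureT_eq, integrable_withDensity_iff (by fun_prop) (by simp), IntegrableOn]
  simp_rw [ENNReal.toReal_ofReal (inv_nonneg.2 (Real.sqrt_nonneg _))]

theorem setIntegral_eq_integral_measureT (h : ℝ → ℝ) :
    ∫ x in Ioo (-1) 1, h x * (√(1 - x ^ 2))⁻¹ = ∫ x, h x ∂measureT := by
  rw [Polynomial.Chebyshev.integral_measureT,
    intervalIntegral.integral_of_le (by norm_num), integral_Ioc_eq_integral_Ioo]
  simp_rw [Real.sqrt_inv]

theorem sqrt_one_sub_sq_pos {x : ℝ} (hx : x ∈ Ioo (-1 : ℝ) 1) : 0 < √(1 - x ^ 2) :=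
  Real.sqrt_pos.2 (by nlinarith [hx.1, hx.2])

theorem integral_eval_T_mul_eval_T (i j : ℕ) :
    ∫ x, (T ℝ (i + 1)).eval x * (T ℝ (j + 1)).eval x ∂measureT =
      if i = j then Real.pi / 2 else 0 := by
  split_ifs with h
  · subst h
    exact_mod_cast Polynomial.Chebyshev.integral_T_real_mul_self_measureT_of_ne_zero
      (Nat.succ_ne_zero i)
  · exact_mod_cast Polynomial.Chebyshev.integral_eval_T_real_mul_eval_T_real_measureT_of_ne
      (Nat.succ_injective.ne h)

theorem integral_eval_U_mul_eval_U (i j : ℕ) :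
    ∫ x, (√(1 - x ^ 2) * (U ℝ i).eval x) * (√(1 - x ^ 2) * (U ℝ j).eval x) ∂measureT =
      if i = j then Real.pi / 2 else 0 := by
  have h1 : ∀ᵐ x ∂measureT, (√(1 - x ^ 2) * (U ℝ i).eval x) * (√(1 - x ^ 2) * (U ℝ j).eval x) =
      1 / 2 * ((T ℝ ((i : ℤ) - j)).eval x - (T ℝ ((i : ℤ) + j + 2)).eval x) := by
    filter_upwards [ae_measureT_mem] with x hx
    have hi := Polynomial.Chebyshev.U_real_cos (Real.arccos x) i
    have hj := Polynomial.Chebyshev.U_real_cos (Real.arccos x) j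
    have h1 := Polynomial.Chebyshev.T_real_cos (Real.arccos x) ((i : ℤ) - j)
    have h2 := Polynomial.Chebyshev.T_real_cos (Real.arccos x) ((i : ℤ) + j + 2)
    rw [Real.cos_arccos hx.1.le hx.2.le] at hi hj h1 h2
    rw [Real.sin_arccos] at hi hj
    rw [mul_comm (√_), mul_comm (√_), hi, hj, h1, h2]
    push_cast
    rw [show ((i : ℝ) - j) * Real.arccos x =
        (i + 1) * Real.arccos x - (j + 1) * Real.arccos x by ring,
      show ((i : ℝ) + j + 2) * Real.arccos x =
        (i + 1) * Real.arccos x + (j + 1) * Real.arccos x by ring, Real.cos_sub, Real.cos_add]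
    ring
  rw [integral_congr_ae h1, integral_const_mul, integral_sub
    (Polynomial.Chebyshev.integrable_measureT (by fun_prop))
    (Polynomial.Chebyshev.integrable_measureT (by fun_prop)),
    Polynomial.Chebyshev.integral_eval_T_real_measureT_of_ne_zero
      (show (i : ℤ) + j + 2 ≠ 0 by positivity)]
  split_ifs with h
  · rw [h, sub_self, Polynomial.Chebyshev.integral_eval_T_real_measureT_zero]
    ring
  · rw [Polynomial.Chebyshev.integral_eval_T_real_measureT_of_ne_zero
      (sub_ne_zero.2 (by exact_mod_cast h))]
    ring

/-- The Abel means of `∑ aₙ₊₁ Uₙ`, where `aₙ = ∫ g Tₙ`, are the integrals of `g` against the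
Chebyshev kernel. -/
theorem hasSum_integral_chebyshevKernel {g : ℝ → ℝ} (hg : Integrable g)
    (hg0 : ∀ y ∉ Ioo (-1 : ℝ) 1, g y = 0) {r x : ℝ} (hr : r ∈ Ioo (0 : ℝ) 1)
    (hx : x ∈ Ioo (-1 : ℝ) 1) :
    HasSum (fun n : ℕ => r ^ (n + 1) * (∫ y, g y * (T ℝ (n + 1)).eval y) * (U ℝ n).eval x)
      (∫ y, g y * chebyshevKernel r x y) := by
  have hs := sqrt_one_sub_sq_pos hx
  have hr1 : |r| < 1 := by rw [abs_of_pos hr.1]; exact hr.2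
  have hU : ∀ n : ℕ, |(U ℝ n).eval x| ≤ (√(1 - x ^ 2))⁻¹ := fun n => by
    have h := abs_sqrt_mul_eval_U_le ⟨hx.1.le, hx.2.le⟩ n
    rwa [abs_mul, abs_of_pos hs, ← le_div_iff₀' hs, one_div] at h
  have hbound : ∀ (n : ℕ) y, ‖g y * (r ^ (n + 1) * (U ℝ n).eval x * (T ℝ (n + 1)).eval y)‖ ≤
      |g y| * (r * r ^ n * (√(1 - x ^ 2))⁻¹) := by
    intro n y
    by_cases hy : y ∈ Ioo (-1 : ℝ) 1
    · rw [norm_mul, norm_mul, norm_mul, Real.norm_eq_abs, Real.norm_eq_abs, Real.norm_eq_abs,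
        Real.norm_eq_abs, abs_of_nonneg (pow_nonneg hr.1.le _), pow_succ']
      refine mul_le_mul_of_nonneg_left ?_ (abs_nonneg _)
      have hp : 0 ≤ r * r ^ n := mul_nonneg hr.1.le (pow_nonneg hr.1.le _)
      have h1 := Polynomial.Chebyshev.abs_eval_T_real_le_one (n + 1)
        (abs_le.2 ⟨hy.1.le, hy.2.le⟩)
      exact (mul_le_of_le_one_right (by positivity) h1).trans
        (mul_le_mul_of_nonneg_left (hU n) hp)
    · simp [hg0 y hy]
  have hint : ∀ n : ℕ,
      Integrable fun y => g y * (r ^ (n + 1) * (U ℝ n).eval x * (T ℝ (n + 1)).eval y) := fun n =>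
    (hg.abs.mul_const _).mono'
      (hg.aestronglyMeasurable.mul (Continuous.aestronglyMeasurable (by fun_prop)))
      (Eventually.of_forall (hbound n))
  have hsum : Summable fun n : ℕ =>
      ∫ y, ‖g y * (r ^ (n + 1) * (U ℝ n).eval x * (T ℝ (n + 1)).eval y)‖ := by
    have hgeo := (((summable_geometric_of_lt_one hr.1.le hr.2).mul_left r).mul_right
      (√(1 - x ^ 2))⁻¹).mul_left (∫ y, |g y|)
    refine Summable.of_nonneg_of_le (fun n => integral_nonneg fun y => norm_nonneg _)
      (fun n => ?_) hgeo
    rw [← integral_mul_const]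
    exact integral_mono (hint n).norm (hg.abs.mul_const _) (hbound n)
  have h := hasSum_integral_of_summable_integral_norm hint hsum
  have h1 : ∀ y, ∑' n : ℕ, g y * (r ^ (n + 1) * (U ℝ n).eval x * (T ℝ (n + 1)).eval y) =
      g y * chebyshevKernel r x y := fun y => by
    by_cases hy : y ∈ Ioo (-1 : ℝ) 1
    · rw [tsum_mul_left, (hasSum_chebyshevKernel hr1 hx ⟨hy.1.le, hy.2.le⟩).tsum_eq]
    · simp [hg0 y hy]
  have h2 : ∀ n : ℕ, ∫ y, g y * (r ^ (n + 1) * (U ℝ n).eval x * (T ℝ (n + 1)).eval y) =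
      r ^ (n + 1) * (∫ y, g y * (T ℝ (n + 1)).eval y) * (U ℝ n).eval x := fun n => by
    rw [mul_right_comm, ← integral_const_mul]
    congr 1
    ext y
    ring
  simp_rw [h1, h2] at h
  exact h

/-! ### Uniqueness for Chebyshev moments -/

theorem linearMap_eq_zero_of_forall_T {Λ : Polynomial ℝ →ₗ[ℝ] ℝ} (h : ∀ n : ℕ, Λ (T ℝ n) = 0) :
    Λ = 0 := by
  have hZ : ∀ n : ℤ, Λ (T ℝ n) = 0 := fun n => by
    rw [← Polynomial.Chebyshev.T_natAbs]
    exact h _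
  have hX : ∀ k : ℕ, ∀ n : ℤ, Λ (Polynomial.X ^ k * T ℝ n) = 0 := by
    intro k
    induction k with
    | zero => simpa using hZ
    | succ k ih =>
      intro n
      have h1 : (2 : ℝ) • (Polynomial.X ^ (k + 1) * T ℝ n) =
          Polynomial.X ^ k * T ℝ (n + 1) + Polynomial.X ^ k * T ℝ (n - 1) := by
        rw [Polynomial.Chebyshev.T_add_one, Polynomial.smul_eq_C_mul, map_ofNat]
        ring
      have h2 := congrArg Λ h1
      rw [map_add, ih, ih, map_smul, smul_eq_mul, add_zero] at h2
      linarith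
  refine Polynomial.lhom_ext' fun k => LinearMap.ext_ring ?_
  have := hX k 0
  simpa [Polynomial.X_pow_eq_monomial] using this

/-- Weierstrass approximation as a uniqueness statement for moments. -/
theorem ae_eq_zero_of_integral_mul_polynomial {h : ℝ → ℝ} (hh : Integrable h)
    (hh0 : ∀ y ∉ Ioo (-1 : ℝ) 1, h y = 0)
    (hp : ∀ p : Polynomial ℝ, ∫ y, h y * p.eval y = 0) : h =ᵐ[volume] 0 := by
  refine ae_eq_zero_of_integral_contDiff_smul_eq_zero hh.locallyIntegrable fun φ hφ hφc => ?_
  have hφi : Integrable fun y => φ y * h y := by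
    obtain ⟨C, hC⟩ := hφ.continuous.bounded_above_of_compact_support hφc
    exact hh.bdd_mul hφ.continuous.aestronglyMeasurable (Eventually.of_forall hC)
  simp_rw [smul_eq_mul]
  rw [← abs_nonpos_iff]
  refine le_of_forall_pos_le_add fun δ hδ => ?_
  have hI : 0 ≤ ∫ y, |h y| := integral_nonneg fun y => abs_nonneg _
  obtain ⟨p, hpφ⟩ := exists_polynomial_near_of_continuousOn (-1) 1 φ hφ.continuous.continuousOn
    (δ / ((∫ y, |h y|) + 1)) (by positivity)
  have hbound : ∀ y, ‖φ y * h y - h y * p.eval y‖ ≤ δ / ((∫ y, |h y|) + 1) * |h y| := fun y => by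
    by_cases hy : y ∈ Ioo (-1 : ℝ) 1
    · rw [mul_comm (h y), ← sub_mul, norm_mul, Real.norm_eq_abs, Real.norm_eq_abs, abs_sub_comm]
      exact mul_le_mul_of_nonneg_right (hpφ y ⟨hy.1.le, hy.2.le⟩).le (abs_nonneg _)
    · simp [hh0 y hy]
  have hdi : Integrable fun y => φ y * h y - h y * p.eval y :=
    (hh.abs.const_mul _).mono' (hφi.aestronglyMeasurable.sub
      (hh.aestronglyMeasurable.mul (Continuous.aestronglyMeasurable (by fun_prop))))
      (Eventually.of_forall hbound)
  have hpi : Integrable fun y => h y * p.eval y := by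
    refine (hφi.sub hdi).congr (Eventually.of_forall fun y => ?_)
    simp
  have heq : ∫ y, φ y * h y = ∫ y, (φ y * h y - h y * p.eval y) := by
    rw [integral_sub hφi hpi, hp, sub_zero]
  rw [heq, zero_add]
  calc |∫ y, (φ y * h y - h y * p.eval y)| ≤ ∫ y, δ / ((∫ y, |h y|) + 1) * |h y| :=
        norm_integral_le_of_norm_le (hh.abs.const_mul _) (Eventually.of_forall hbound)
    _ = δ * ((∫ y, |h y|) / ((∫ y, |h y|) + 1)) := by
        rw [integral_const_mul]
        ring
    _ ≤ δ := mul_le_of_le_one_right hδ.le ((div_le_one (by positivity)).2 (by linarith))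

theorem integrable_indicator_inv_sqrt_mul (c : ℝ) {p : ℝ → ℝ} (hp : Continuous p) :
    Integrable fun x => (Ioo (-1 : ℝ) 1).indicator (fun x => c / √(1 - x ^ 2)) x * p x := by
  have h := integrable_measureT_iff.1 (Polynomial.Chebyshev.integrable_measureT
    (f := fun x => c * p x) (by fun_prop))
  rw [← integrable_indicator_iff measurableSet_Ioo] at h
  refine h.congr (Eventually.of_forall fun x => ?_)
  by_cases hx : x ∈ Ioo (-1 : ℝ) 1
  · simp only [indicator_of_mem hx]
    ring
  · simp only [indicator_of_notMem hx, zero_mul]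

theorem integral_indicator_inv_sqrt_mul (c : ℝ) (p : ℝ → ℝ) :
    ∫ x, (Ioo (-1 : ℝ) 1).indicator (fun x => c / √(1 - x ^ 2)) x * p x =
      c * ∫ x, p x ∂measureT := by
  rw [← integral_const_mul, ← setIntegral_eq_integral_measureT,
    ← integral_indicator measurableSet_Ioo]
  congr 1
  ext x
  by_cases hx : x ∈ Ioo (-1 : ℝ) 1
  · simp only [indicator_of_mem hx]
    ring
  · simp only [indicator_of_notMem hx, zero_mul]

/-- An integrable function on `(-1, 1)` orthogonal to all `T n` with `n ≥ 1` is a multiple of the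
Chebyshev weight. -/
theorem ae_eq_const_div_sqrt_of_integral_mul_T {g : ℝ → ℝ} (hg : Integrable g)
    (hg0 : ∀ y ∉ Ioo (-1 : ℝ) 1, g y = 0)
    (hT : ∀ n : ℕ, ∫ y, g y * (T ℝ (n + 1)).eval y = 0) :
    g =ᵐ[volume] (Ioo (-1 : ℝ) 1).indicator
      (fun x => ((∫ y, g y) / Real.pi) / √(1 - x ^ 2)) := by
  obtain ⟨c, hc⟩ : ∃ c, c = (∫ y, g y) / Real.pi := ⟨_, rfl⟩
  rw [← hc]
  set k := (Ioo (-1 : ℝ) 1).indicator (fun x => c / √(1 - x ^ 2)) with hk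
  have hk0 : ∀ y ∉ Ioo (-1 : ℝ) 1, k y = 0 := fun y hy => indicator_of_notMem hy _
  have hki : ∀ p : Polynomial ℝ, Integrable fun y => k y * p.eval y := fun p =>
    integrable_indicator_inv_sqrt_mul c p.continuous
  have hgi : ∀ p : Polynomial ℝ, Integrable fun y => g y * p.eval y := fun p => by
    have h : IntegrableOn (fun y => g y * p.eval y) (Icc (-1) 1) :=
      hg.integrableOn.mul_continuousOn p.continuous.continuousOn isCompact_Icc
    rw [← integrable_indicator_iff measurableSet_Icc] at h
    refine h.congr (Eventually.of_forall fun y => ?_)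
    by_cases hy : y ∈ Icc (-1 : ℝ) 1
    · simp only [indicator_of_mem hy]
    · simp only [indicator_of_notMem hy, hg0 y fun h => hy (Ioo_subset_Icc_self h), zero_mul]
  have hhi : ∀ p : Polynomial ℝ, Integrable fun y => (g y - k y) * p.eval y := fun p => by
    simp_rw [sub_mul]
    exact (hgi p).sub (hki p)
  let Λ : Polynomial ℝ →ₗ[ℝ] ℝ :=
    { toFun := fun p => ∫ y, (g y - k y) * p.eval y
      map_add' := fun p q => by
        simp_rw [Polynomial.eval_add, mul_add]
        exact integral_add (hhi p) (hhi q)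
      map_smul' := fun a p => by
        simp_rw [Polynomial.eval_smul, smul_eq_mul, mul_left_comm _ a]
        exact integral_const_mul _ _ }
  have hΛ : Λ = 0 := by
    refine linearMap_eq_zero_of_forall_T fun n => ?_
    change ∫ y, (g y - k y) * (T ℝ n).eval y = 0
    simp_rw [sub_mul]
    rw [integral_sub (hgi _) (hki _), hk, integral_indicator_inv_sqrt_mul]
    rcases n with _ | n
    · rw [Nat.cast_zero, Polynomial.Chebyshev.integral_eval_T_real_measureT_zero, hc]
      simp [Real.pi_ne_zero]
    · rw [Polynomial.Chebyshev.integral_eval_T_real_measureT_of_ne_zero (by positivity), mul_zero,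
        sub_zero]
      exact_mod_cast hT n
  have hh : Integrable fun y => g y - k y := by simpa using hhi 1
  have h0 := ae_eq_zero_of_integral_mul_polynomial hh
    (fun y hy => by rw [hg0 y hy, hk0 y hy, sub_zero]) fun p => LinearMap.congr_fun hΛ p
  filter_upwards [h0] with y hy
  exact sub_eq_zero.1 hy

/-! ### Functions with vanishing Hilbert transform -/

/-- The weighted condition on `f` in terms of the Chebyshev measure; this is where the exponent
`1 / 4` enters. -/
theorem memLp_mul_sqrt_measureT {f : ℝ → ℝ}
    (hf : MemLp (fun x : ℝ => f x * (1 - x ^ 2) ^ (1 / 4 : ℝ)) 2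
      (volume.restrict (Ioo (-1 : ℝ) 1))) :
    MemLp (fun x => f x * √(1 - x ^ 2)) 2 measureT := by
  have hq : ∀ x ∈ Ioo (-1 : ℝ) 1,
      (1 - x ^ 2) ^ (1 / 4 : ℝ) * (1 - x ^ 2) ^ (1 / 4 : ℝ) = √(1 - x ^ 2) := fun x hx => by
    rw [← Real.rpow_add (by nlinarith [hx.1, hx.2]), Real.sqrt_eq_rpow]
    norm_num
  have hm : AEStronglyMeasurable (fun x => f x * √(1 - x ^ 2)) measureT := by
    have hw : AEStronglyMeasurable (fun x : ℝ => (1 - x ^ 2) ^ (1 / 4 : ℝ))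
        (volume.restrict (Ioo (-1 : ℝ) 1)) :=
      Measurable.aestronglyMeasurable (by fun_prop)
    have h := (hf.aestronglyMeasurable.mul hw).mono_ac measureT_absolutelyContinuous
    refine h.congr ?_
    filter_upwards [ae_measureT_mem] with x hx
    simp only [Pi.mul_apply]
    rw [mul_assoc, hq x hx]
  rw [memLp_two_iff_integrable_sq hm, integrable_measureT_iff]
  refine (hf.integrable_sq).congr ?_
  filter_upwards [ae_restrict_mem measurableSet_Ioo] with x hx
  have hs := sqrt_one_sub_sq_pos hx
  rw [mul_pow, sq ((1 - x ^ 2) ^ (1 / 4 : ℝ)), hq x hx]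
  field_simp

theorem theorem1 (f : ℝ → ℝ)
    (hf : MemLp (fun x : ℝ => f x * (1 - x ^ 2) ^ (1 / 4 : ℝ)) 2
      (volume.restrict (Ioo (-1 : ℝ) 1)))
    (hH : ∀ᵐ x ∂(volume.restrict (Ioo (-1 : ℝ) 1)),
      HasHilbertTransformAt ((Ioo (-1 : ℝ) 1).indicator f) 0 x) :
    ∃ c : ℝ, (Ioo (-1 : ℝ) 1).indicator f =ᵐ[volume]
      (Ioo (-1 : ℝ) 1).indicator (fun x : ℝ => c / Real.sqrt (1 - x ^ 2)) := by
  have hF := memLp_mul_sqrt_measureT hf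
  have hFi : Integrable (fun x => f x * √(1 - x ^ 2)) measureT := hF.integrable one_le_two
  set g := (Ioo (-1 : ℝ) 1).indicator f with hgdef
  have hg0 : ∀ y ∉ Ioo (-1 : ℝ) 1, g y = 0 := fun y hy => indicator_of_notMem hy _
  have hg : Integrable g := by
    rw [hgdef, integrable_indicator_iff measurableSet_Ioo]
    refine (integrable_measureT_iff.1 hFi).congr ?_
    filter_upwards [ae_restrict_mem measurableSet_Ioo] with x hx
    exact mul_inv_cancel_right₀ (sqrt_one_sub_sq_pos hx).ne' _
  have hcoef : ∀ n : ℕ, ∫ y, g y * (T ℝ (n + 1)).eval y =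
      ∫ y, f y * √(1 - y ^ 2) * (T ℝ (n + 1)).eval y ∂measureT := fun n => by
    rw [← setIntegral_eq_integral_measureT, ← integral_indicator measurableSet_Ioo]
    congr 1
    ext y
    by_cases hy : y ∈ Ioo (-1 : ℝ) 1
    · have := sqrt_one_sub_sq_pos hy
      simp only [hgdef, indicator_of_mem hy]
      field_simp
    · simp only [hgdef, indicator_of_notMem hy, zero_mul]
  have hbT : ∀ᵐ x ∂measureT, ∀ n : ℕ, |(T ℝ (n + 1)).eval x| ≤ 1 := by
    filter_upwards [ae_measureT_mem] with x hx n
    exact Polynomial.Chebyshev.abs_eval_T_real_le_one _ (abs_le.2 ⟨hx.1.le, hx.2.le⟩)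
  have hbU : ∀ᵐ x ∂measureT, ∀ n : ℕ, |√(1 - x ^ 2) * (U ℝ n).eval x| ≤ 1 := by
    filter_upwards [ae_measureT_mem] with x hx n
    exact abs_sqrt_mul_eval_U_le ⟨hx.1.le, hx.2.le⟩ n
  have hmT : ∀ n : ℕ, AEStronglyMeasurable (fun x => (T ℝ (n + 1)).eval x) measureT := fun n =>
    Continuous.aestronglyMeasurable (by fun_prop)
  have hmU : ∀ n : ℕ, AEStronglyMeasurable (fun x => √(1 - x ^ 2) * (U ℝ n).eval x) measureT :=
    fun n => Continuous.aestronglyMeasurable (by fun_prop)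
  have hpi : 0 < Real.pi / 2 := by positivity
  have hbessel := bessel_of_orthogonal (integrable_mul_of_abs_le_one hmT hbT)
    integral_eval_T_mul_eval_T hpi hF.integrable_sq fun n =>
      hFi.mul_bdd (hmT n) (hbT.mono fun x hx => hx n)
  simp_rw [← hcoef] at hbessel
  have hzero := eq_zero_of_tendsto_abel hmU hbU integral_eval_U_mul_eval_U hpi hbessel ?_
  · exact ⟨_, ae_eq_const_div_sqrt_of_integral_mul_T hg hg0 hzero⟩
  · filter_upwards [ae_measureT_mem, measureT_absolutelyContinuous.ae_le hH] with x hx hxH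
    have h := (tendsto_integral_chebyshevKernel hg hx hxH).const_mul √(1 - x ^ 2)
    rw [mul_zero] at h
    refine h.congr' ?_
    filter_upwards [Ioo_mem_nhdsLT (zero_lt_one (α := ℝ))] with r hr
    rw [← ((hasSum_integral_chebyshevKernel hg hg0 hr hx).mul_left _).tsum_eq]
    exact tsum_congr fun n => by ring
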